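/- Let $d\ge 0$ be an integer. For $n\in\mathbb N$ let $\mathcal X_n$ be the set of all continuous paths $\mathbf x:[0,T]\to\mathbb R^n$ of bounded variation with $\mathbf x(0)=0$, where the end time $T=T_{\mathbf x}>0$ may depend on the path. Equip $\mathcal X_n$ with the 1-variation metric $$\rho(\mathbf x,\mathbf y)=|T_{\mathbf x}-T_{\mathbf y}|+\big\|\mathbf x(\cdot\wedge T_{\mathbf x})-\mathbf y(\cdot\wedge T_{\mathbf y})\big\|_{1},\qquad \|\mathbf z\|_1=\sup_{t_0<\dots<t_N}\sum_{i=1}^N|\mathbf z(t_i)-\mathbf z(t_{i-1})|,$$ so that $\rho(\mathbf x,\mathbf y)=\|\mathbf x-\mathbf y\|_1$ when $T_{\mathbf x}=T_{\mathbf y}$, and with the corresponding Borel $\sigma$-algebra; subsets carry the subspace structures. For $\mathbf x\in\mathcal X_n$ and $m\ge 0$ let $$\int d\mathbf x^{\otimes m}=\Big(\int_{0<t_1<\dots<t_m<T}d\mathbf x^{i_1}(t_1)\cdots d\mathbf x^{i_m}(t_m)\Big)_{i_1,\dots,i_m}\in(\mathbb R^n)^{\otimes m}$$ (iterated Stieltjes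 integrals; equal to $1$ for $m=0$), let $\Phi_{\mathsf{Sig}}(\mathbf x)=(\int d\mathbf x^{\otimes m})_{m\ge 0}$ be the signature of $\mathbf x$, and for $\mathbf w\in\bigoplus_{m\ge0}(\mathbb R^n)^{\otimes m}$ (finitely many non-zero coordinates) let $\langle\mathbf w,\Phi_{\mathsf{Sig}}(\mathbf x)\rangle$ be the sum of the products of corresponding coordinates. For $\mathbf x\in\mathcal X_d$ let $\bar{\mathbf x}\in\mathcal X_{d+1}$ be the time-augmented path $\bar{\mathbf x}(t)=(t,\mathbf x(t))$, $t\in[0,T_{\mathbf x}]$. Let $\mathcal K\subset\mathcal X_d$ be compact and $\bar{\mathcal K}=\{\bar{\mathbf x}:\mathbf x\in\mathcal K\}\subset\mathcal X_{d+1}$. 1. For every $f\in C_b(\bar{\mathcal K},\mathbb R)$ and $\epsilon>0$ there is $\mathbf w\in\bigoplus_{m\ge 0}(\mathbb R^{d+1})^{\otimes m}$ such that $\sup_{\mathbf x\in\mathcal K}|f(\bar{\mathbf x})-\langle\mathbf w,\Phi_{\mathsf{Sig}}(\bar{\mathbf x})\rangle|<\epsilon$. 2. For every $\mathcal K$-valued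 random variable $\mathbf X$ and every $m\ge 0$ the expectation $\mathbb E[\int d\bar{\mathbf X}^{\otimes m}]$ exists, and the expected signature map $\operatorname{Law}(\bar{\mathbf X})\mapsto\mathbb E[\Phi_{\mathsf{Sig}}(\bar{\mathbf X})]=(\mathbb E[\int d\bar{\mathbf X}^{\otimes m}])_{m\ge0}$ is injective: if $\mathbf X,\mathbf Y$ are $\mathcal K$-valued random variables (possibly on different probability spaces) with the same expected signature of $\bar{\mathbf X}$ and $\bar{\mathbf Y}$, then $\operatorname{Law}(\bar{\mathbf X})=\operatorname{Law}(\bar{\mathbf Y})$. 3. For $\mathcal K$-valued random variables $\mathbf X,\mathbf X_1,\mathbf X_2,\dots$ (possibly on different probability spaces) the following are equivalent: (a) for all $f\in C_b(\bar{\mathcal K},\mathbb R)$, $\lim_{k\to\infty}\mathbb E[f(\bar{\mathbf X}_k)]=\mathbb E[f(\bar{\mathbf X})]$; (b) for all $m\in\mathbb N$, $\lim_{k\to\infty}\mathbb E[\int d\bar{\mathbf X}_k^{\otimes m}]=\mathbb E[\int d\bar{\mathbf X}^{\otimes m}]$. -/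

import Mathlib

open MeasureTheory Filter Topology
open scoped ENNReal BoundedContinuousFunction

/-- A continuous path `x : [0, T] → ℝⁿ` of bounded variation with `x 0 = 0`; the end time `T > 0`
is part of the data, so that different paths may live on different intervals. -/
structure BVPath (n : ℕ) where
  T : ℝ
  T_pos : 0 < T
  toFun : C(Set.Icc (0 : ℝ) T, EuclideanSpace ℝ (Fin n))
  boundedVariation : BoundedVariationOn toFun Set.univ
  map_zero : toFun ⟨0, Set.left_mem_Icc.2 T_pos.le⟩ = 0

/-- Subadditivity of the variation under a pointwise bound on increments. -/
theorem eVariationOn_le_add_of_edist_le {α E F G : Type*} [LinearOrder α]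
    [PseudoEMetricSpace E] [PseudoEMetricSpace F] [PseudoEMetricSpace G]
    {f : α → E} {g : α → F} {h : α → G} {s : Set α}
    (H : ∀ a b, edist (h a) (h b) ≤ edist (f a) (f b) + edist (g a) (g b)) :
    eVariationOn h s ≤ eVariationOn f s + eVariationOn g s := by
  refine iSup_le fun p => ?_
  calc _ ≤ ∑ i ∈ Finset.range p.1, (edist (f (p.2.1 (i + 1))) (f (p.2.1 i)) +
          edist (g (p.2.1 (i + 1))) (g (p.2.1 i))) := Finset.sum_le_sum fun i _ => H _ _
    _ = _ := Finset.sum_add_distrib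
    _ ≤ _ := add_le_add (eVariationOn.sum_le p.2.2.1 p.2.2.2)
        (eVariationOn.sum_le p.2.2.1 p.2.2.2)

namespace BVPath

/-- The path stopped at its end time: equal to `x` on `[0, T]`, to `x T` after time `T`, and to
`x 0 = 0` before time `0`. -/
noncomputable def stopped {n : ℕ} (x : BVPath n) : ℝ → EuclideanSpace ℝ (Fin n) :=
  Set.IccExtend x.T_pos.le x.toFun

theorem stopped_boundedVariation {n : ℕ} (x : BVPath n) :
    BoundedVariationOn x.stopped Set.univ :=
  ne_top_of_le_ne_top x.boundedVariation
    (eVariationOn.comp_le_of_monotoneOn _ _ ((Set.monotone_projIcc x.T_pos.le).monotoneOn _)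
      fun _ _ => Set.mem_univ _)

theorem stopped_zero {n : ℕ} (x : BVPath n) : x.stopped 0 = 0 := by
  rw [stopped, Set.IccExtend_of_mem _ _ (Set.left_mem_Icc.2 x.T_pos.le)]
  exact x.map_zero

theorem coord_boundedVariation {n : ℕ} (x : BVPath n) (i : Fin n) :
    BoundedVariationOn (fun t => x.stopped t i) Set.univ :=
  (EuclideanSpace.proj (𝕜 := ℝ) i : EuclideanSpace ℝ (Fin n) →L[ℝ] ℝ).lipschitz.comp_boundedVariationOn
    x.stopped_boundedVariation

theorem sub_boundedVariation {n : ℕ} (x y : BVPath n) :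
    BoundedVariationOn (fun t => x.stopped t - y.stopped t) Set.univ :=
  ne_top_of_le_ne_top (ENNReal.add_ne_top.2 ⟨x.stopped_boundedVariation,
    y.stopped_boundedVariation⟩)
    (eVariationOn_le_add_of_edist_le fun a b => by
      have := edist_add_add_le (x.stopped a) (-y.stopped a) (x.stopped b) (-y.stopped b)
      rwa [edist_neg_neg, ← sub_eq_add_neg, ← sub_eq_add_neg] at this)

/-- The 1-variation metric: the 1-variation of the difference of the two stopped paths plus the
distance of the end times. On paths with the same interval `[0, T]` it is `‖x - y‖₁`. -/
noncomputable instance instMetricSpace (n : ℕ) : MetricSpace (BVPath n) where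
  dist x y := |x.T - y.T| +
    (eVariationOn (fun t => x.stopped t - y.stopped t) Set.univ).toReal
  dist_self x := by
    have : eVariationOn (fun t => x.stopped t - x.stopped t) Set.univ = 0 := by
      rw [eVariationOn.eq_zero_iff]; simp
    rw [this, sub_self, abs_zero, ENNReal.toReal_zero, add_zero]
  dist_comm x y := by
    have : eVariationOn (fun t => x.stopped t - y.stopped t) Set.univ =
        eVariationOn (fun t => y.stopped t - x.stopped t) Set.univ := by
      have h (a b : ℝ) : edist (x.stopped a - y.stopped a) (x.stopped b - y.stopped b) =
          edist (y.stopped a - x.stopped a) (y.stopped b - x.stopped b) := by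
        rw [← edist_neg_neg, neg_sub, neg_sub]
      simp only [eVariationOn, h]
    simp only [this, abs_sub_comm]
  dist_triangle x y z := by
    have h : eVariationOn (fun t => x.stopped t - z.stopped t) Set.univ ≤
        eVariationOn (fun t => x.stopped t - y.stopped t) Set.univ +
          eVariationOn (fun t => y.stopped t - z.stopped t) Set.univ :=
      eVariationOn_le_add_of_edist_le fun a b => by
        have := edist_add_add_le (x.stopped a - y.stopped a) (y.stopped a - z.stopped a)
          (x.stopped b - y.stopped b) (y.stopped b - z.stopped b)
        simpa using this
    have h1 := ENNReal.toReal_mono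
      (ENNReal.add_ne_top.2 ⟨sub_boundedVariation x y, sub_boundedVariation y z⟩) h
    rw [ENNReal.toReal_add (sub_boundedVariation x y) (sub_boundedVariation y z)] at h1
    have h2 := abs_sub_le x.T y.T z.T
    linarith
  eq_of_dist_eq_zero {x y} h := by
    have h0 : 0 ≤ |x.T - y.T| := abs_nonneg _
    have h1 : 0 ≤ (eVariationOn (fun t => x.stopped t - y.stopped t) Set.univ).toReal :=
      ENNReal.toReal_nonneg
    have hT : x.T = y.T := by
      have : |x.T - y.T| = 0 := by linarith
      exact sub_eq_zero.1 (abs_eq_zero.1 this)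
    have hv : eVariationOn (fun t => x.stopped t - y.stopped t) Set.univ = 0 := by
      have : (eVariationOn (fun t => x.stopped t - y.stopped t) Set.univ).toReal = 0 := by
        linarith
      exact (ENNReal.toReal_eq_zero_iff _).1 this |>.resolve_right (sub_boundedVariation x y)
    have hs : ∀ t, x.stopped t = y.stopped t := fun t => by
      have := (eVariationOn.eq_zero_iff _).1 hv t (Set.mem_univ _) 0 (Set.mem_univ _)
      rw [edist_eq_zero, stopped_zero, stopped_zero, sub_zero] at this
      exact sub_eq_zero.1 this
    obtain ⟨T, hT0, f, hf, hf0⟩ := x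
    obtain ⟨T', hT0', g, hg, hg0⟩ := y
    obtain rfl : T = T' := hT
    obtain rfl : f = g := by
      ext1 t
      simpa [stopped, Set.IccExtend_of_mem _ _ t.2] using hs t
    rfl

/-- The path space carries its Borel `σ`-algebra. -/
noncomputable instance instMeasurableSpace (n : ℕ) : MeasurableSpace (BVPath n) := borel _

instance instBorelSpace (n : ℕ) : BorelSpace (BVPath n) := ⟨rfl⟩

/-- The time-augmented path `t ↦ (t, x t)` in `ℝⁿ⁺¹`, on the same interval `[0, T]`. -/
noncomputable def timeAugment {n : ℕ} (x : BVPath n) : BVPath (n + 1) where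
  T := x.T
  T_pos := x.T_pos
  toFun :=
    { toFun := fun t => WithLp.toLp 2 (Fin.cons (t : ℝ) (x.toFun t) : Fin (n + 1) → ℝ)
      continuous_toFun := by
        refine (PiLp.continuous_toLp 2 _).comp (continuous_pi fun i => ?_)
        refine Fin.cases ?_ (fun j => ?_) i
        · simpa using continuous_subtype_val
        · simp only [Fin.cons_succ]
          fun_prop }
  boundedVariation := by
    refine ne_top_of_le_ne_top (ENNReal.add_ne_top.2 ⟨?_, x.boundedVariation⟩)
      (eVariationOn_le_add_of_edist_le (f := fun t : Set.Icc (0 : ℝ) x.T => (t : ℝ))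
        fun a b => ?_)
    · refine MonotoneOn.boundedVariationOn (C := x.T) (fun a _ b _ h => h) fun t _ => ?_
      rw [abs_of_nonneg t.2.1]
      exact t.2.2
    · simp only [ContinuousMap.coe_mk, edist_dist]
      rw [← ENNReal.ofReal_add dist_nonneg dist_nonneg]
      refine ENNReal.ofReal_le_ofReal ?_
      rw [EuclideanSpace.dist_eq, EuclideanSpace.dist_eq, Fin.sum_univ_succ]
      simp only [Fin.cons_zero, Fin.cons_succ]
      have hs : 0 ≤ ∑ i, dist (x.toFun a i) (x.toFun b i) ^ 2 :=
        Finset.sum_nonneg fun _ _ => sq_nonneg _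
      rw [Real.sqrt_le_iff]
      refine ⟨by positivity, ?_⟩
      nlinarith [Real.sq_sqrt hs, Real.sqrt_nonneg (∑ i, dist (x.toFun a i) (x.toFun b i) ^ 2),
        dist_nonneg (x := (a : ℝ)) (y := (b : ℝ))]
  map_zero := by
    ext i
    refine Fin.cases ?_ (fun j => ?_) i
    · simp
    · simp [x.map_zero]

/-- The iterated Stieltjes integrals of `x` up to time `t`,
`∫_{0 < t₁ < ⋯ < tₘ < t} dx^{i₁}(t₁) ⋯ dx^{iₘ}(tₘ)`,
computed by integrating out `t₁`, then `t₂`, and so on, against the signed Stieltjes measures of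
the coordinate paths. -/
noncomputable def iteratedIntegral {n : ℕ} (x : BVPath n) :
    (m : ℕ) → (Fin m → Fin n) → ℝ → ℝ
  | 0, _, _ => 1
  | m + 1, I, t =>
    ∫ᵛ s in Set.Ioo 0 t, iteratedIntegral x m (Fin.init I) s
      ∂•(x.coord_boundedVariation (I (Fin.last m))).vectorMeasure

/-- The degree `m` part `∫ dx^{⊗m}` of the signature, an element of `(ℝⁿ)^{⊗m}` given by its
coordinates `(i₁, …, iₘ)`. -/
noncomputable def signature {n : ℕ} (x : BVPath n) (m : ℕ) : (Fin m → Fin n) → ℝ :=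
  fun I => x.iteratedIntegral m I x.T

/-- The pairing `⟨w, Φ(x)⟩ = ∑_I w^I ∫ dx^{i₁} ⋯ dx^{iₘ}` of the signature with
`w ∈ ⨁ₘ (ℝⁿ)^{⊗m}`, where `w` is given by its coordinates `w^I`, of which only finitely many are
non-zero, `I` ranging over the multi-indices of all lengths. -/
noncomputable def pairing {n : ℕ} (w : (Σ m : ℕ, (Fin m → Fin n)) →₀ ℝ) (x : BVPath n) : ℝ :=
  w.sum fun I c => c * x.signature I.1 I.2

/-- The map `x ↦ x̄` from `K` to `K̄ = {x̄ : x ∈ K}`; the latter has the subspace topology. -/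
noncomputable def augmentOn {n : ℕ} (K : Set (BVPath n)) (x : K) : (timeAugment '' K) :=
  ⟨timeAugment x, Set.mem_image_of_mem _ x.2⟩

end BVPath

/-! All three claims follow from the Stone–Weierstrass theorem on the compact set of augmented
paths, applied to the linear functionals of the signature. Three facts make it applicable.

Continuity (`continuous_signature`): the Stieltjes measure of a coordinate depends on the path in a
1-Lipschitz way, so iterated integrals converge uniformly in time when the paths converge, by
induction on the degree.

Algebra (`mul_mem_span`): integration by parts writes a product of two iterated integrals as a sum
of iterated integrals. Paths are continuous, so their measures have no atoms and the diagonal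
contributes nothing.

Separation (`eq_of_forall_mem_span_eq`): the time coordinate alone gives the end time. By the
shuffle property the functionals also include every moment `∫ xʲ(s) sᵏ ds`, and these determine a
continuous path.

For random paths, the expectation of a linear functional depends only on the expected signature
(`integral_pairing`). Uniform approximation of a test function then transfers both equality and
convergence from expected signatures to all bounded continuous functions. -/

/-- Brings integrals against a signed measure into the form in which those against `toSignedMeasure`
reduce to Bochner integrals. -/
theorem ContinuousLinearMap.lsmul_real_eq_flip :
    ContinuousLinearMap.lsmul ℝ ℝ =
      (ContinuousLinearMap.lsmul ℝ ℝ : ℝ →L[ℝ] ℝ →L[ℝ] ℝ).flip := by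
  ext; simp

theorem Real.measurableSpace_eq_generateFrom_Ioc :
    (inferInstance : MeasurableSpace ℝ) =
      MeasurableSpace.generateFrom {S | ∃ l u : ℝ, l < u ∧ Set.Ioc l u = S} := by
  rw [← borel_eq_generateFrom_Ioc ℝ]
  exact BorelSpace.measurable_eq

theorem Real.iUnion_Ioc_neg_natCast : ⋃ n : ℕ, Set.Ioc (-(n : ℝ)) n = Set.univ := by
  refine Set.eq_univ_of_forall fun x => ?_
  obtain ⟨n, hn⟩ := exists_nat_gt |x|
  exact Set.mem_iUnion.2 ⟨n, by linarith [(abs_lt.1 hn).1], (abs_lt.1 hn).2.le⟩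

theorem Real.monotone_Ioc_neg_natCast : Monotone fun n : ℕ => Set.Ioc (-(n : ℝ)) n :=
  fun _ _ h => Set.Ioc_subset_Ioc (neg_le_neg (Nat.cast_le.2 h)) (Nat.cast_le.2 h)

/-! ### Signed measures on the real line and their indefinite integrals -/

namespace MeasureTheory.SignedMeasure

/-- Half-open intervals form a generating π-system; the total mass, needed separately, is the limit
along `Ioc (-n) n`. -/
theorem ext_of_Ioc {μ ν : SignedMeasure ℝ}
    (h : ∀ a b, a < b → μ (Set.Ioc a b) = ν (Set.Ioc a b)) : μ = ν := by
  refine VectorMeasure.ext_of_generateFrom _ ?_ Real.measurableSpace_eq_generateFrom_Ioc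
    (isPiSystem_Ioc id id) ?_
  · rintro _ ⟨a, b, hab, rfl⟩
    exact h a b hab
  · have hlim (ρ : SignedMeasure ℝ) : Tendsto (fun n : ℕ => ρ (Set.Ioc (-(n : ℝ)) n)) atTop
        (𝓝 (ρ Set.univ)) := by
      rw [← Real.iUnion_Ioc_neg_natCast]
      exact VectorMeasure.tendsto_vectorMeasure_iUnion_atTop_nat Real.monotone_Ioc_neg_natCast
        fun _ => measurableSet_Ioc
    refine tendsto_nhds_unique (hlim μ) ((hlim ν).congr fun n => ?_)
    rcases (neg_nonpos.2 n.cast_nonneg |>.trans n.cast_nonneg : -(n : ℝ) ≤ n).eq_or_lt with e | e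
    · simp [e]
    · exact (h _ _ e).symm

instance isFiniteMeasure_variation {X : Type*} [MeasurableSpace X] (μ : SignedMeasure X) :
    IsFiniteMeasure μ.variation := by
  rw [← totalVariation_eq_variation]
  infer_instance

theorem posPart_le_variation {X : Type*} [MeasurableSpace X] (μ : SignedMeasure X) :
    μ.toJordanDecomposition.posPart ≤ μ.variation := by
  rw [← totalVariation_eq_variation]
  exact Measure.le_add_right le_rfl

theorem negPart_le_variation {X : Type*} [MeasurableSpace X] (μ : SignedMeasure X) :
    μ.toJordanDecomposition.negPart ≤ μ.variation := by
  rw [← totalVariation_eq_variation]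
  exact Measure.le_add_left le_rfl

/-- A signed measure is dominated by a finite measure as soon as it is on half-open intervals. -/
theorem variation_le_of_Ioc {μ : SignedMeasure ℝ} {ν : Measure ℝ} [IsFiniteMeasure ν]
    {f : ℝ → ℝ} (hμ : ∀ a b, a ≤ b → μ (Set.Ioc a b) = f b - f a)
    (h : ∀ a b, a ≤ b → ‖f b - f a‖ₑ ≤ ν (Set.Ioc a b)) : μ.variation ≤ ν := by
  have B : (inferInstance : MeasurableSpace ℝ) =
      MeasurableSpace.generateFrom {s | ∃ u v : ℝ, u ≤ v ∧ s = Set.Ioc u v} := by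
    rw [BorelSpace.measurable_eq (α := ℝ), borel_eq_generateFrom_Ioc_le ℝ]
    simp only [eq_comm]
  -- The increments of `f` form an additive content on the semiring of half-open intervals. Being
  -- dominated by `ν`, it extends to a measure dominated by `ν` on every set; uniqueness identifies
  -- this extension with `μ`.
  obtain ⟨m, hm, hmν⟩ :=
    VectorMeasure.exists_extension_of_isSetSemiring_of_le_measure_of_generateFrom (μ := ν)
      (m := AddContent.onIoc f) IsSetSemiring.Ioc
      (by
        rintro _ ⟨a, b, hab, rfl⟩
        rw [AddContent.onIoc_apply hab]
        exact h a b hab) B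
  have : μ = m := ext_of_Ioc fun a b hab => by
    rw [hm _ ⟨a, b, hab.le, rfl⟩, AddContent.onIoc_apply hab.le, hμ a b hab.le]
  rw [this]
  exact VectorMeasure.variation_le_of_forall_enorm_le fun s _ => hmν s

/-- Jordan decomposition: reduces to positive measures, for which Fubini is at hand. -/
theorem setIntegral_eq_sub {X : Type*} [MeasurableSpace X] (μ : SignedMeasure X) {s : Set X}
    (hs : MeasurableSet s) {f : X → ℝ} (hf : μ.Integrable f) :
    ∫ᵛ x in s, f x ∂•μ = ∫ x in s, f x ∂μ.toJordanDecomposition.posPart -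
      ∫ x in s, f x ∂μ.toJordanDecomposition.negPart := by
  have hp : μ.toJordanDecomposition.posPart.toSignedMeasure.Integrable (s.indicator f) := by
    rw [VectorMeasure.Integrable, Measure.variation_toSignedMeasure]
    exact (hf.mono_measure μ.posPart_le_variation).indicator hs
  have hn : μ.toJordanDecomposition.negPart.toSignedMeasure.Integrable (s.indicator f) := by
    rw [VectorMeasure.Integrable, Measure.variation_toSignedMeasure]
    exact (hf.mono_measure μ.negPart_le_variation).indicator hs
  rw [← VectorMeasure.integral_indicator hs]
  conv_lhs => rw [← μ.toSignedMeasure_toJordanDecomposition]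
  rw [JordanDecomposition.toSignedMeasure, VectorMeasure.integral_sub_vectorMeasure hp hn,
    ContinuousLinearMap.lsmul_real_eq_flip, VectorMeasure.integral_toSignedMeasure, VectorMeasure.integral_toSignedMeasure,
    integral_indicator hs, integral_indicator hs]

theorem integrable_of_bounded {X : Type*} [MeasurableSpace X] (μ : SignedMeasure X) {f : X → ℝ}
    (hf : Measurable f) {C : ℝ} (hC : ∀ x, |f x| ≤ C) : μ.Integrable f :=
  Integrable.of_bound (μ := μ.variation) hf.aestronglyMeasurable C (Eventually.of_forall hC)

theorem abs_setIntegral_le {X : Type*} [MeasurableSpace X] (μ : SignedMeasure X) {s : Set X}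
    {f : X → ℝ} {C : ℝ} (hC0 : 0 ≤ C) (hC : ∀ x, |f x| ≤ C) :
    |∫ᵛ x in s, f x ∂•μ| ≤ C * μ.variation.real Set.univ := by
  have h := VectorMeasure.norm_setIntegral_le_of_norm_le_const (μ := μ) (s := s)
    (B := ContinuousLinearMap.lsmul ℝ ℝ) (C := C) (f := f) fun x _ => hC x
  have h1 : ‖(ContinuousLinearMap.lsmul ℝ ℝ : ℝ →L[ℝ] ℝ →L[ℝ] ℝ)‖ ≤ 1 :=
    ContinuousLinearMap.opNorm_lsmul_le
  calc _ ≤ _ := h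
    _ ≤ C * 1 * μ.variation.real Set.univ := by
      gcongr
      · finiteness
      · exact Set.subset_univ _
    _ = _ := by rw [mul_one]

/-- The indefinite integral against an atomless signed measure is continuous. -/
theorem continuous_setIntegral_Ioo (μ : SignedMeasure ℝ) (hμ : ∀ a, μ.variation {a} = 0)
    {f : ℝ → ℝ} (hf : Measurable f) {C : ℝ} (hC : ∀ x, |f x| ≤ C) :
    Continuous fun t => ∫ᵛ s in Set.Ioo 0 t, f s ∂•μ := by
  simp_rw [← VectorMeasure.integral_indicator measurableSet_Ioo]
  refine continuous_iff_continuousAt.2 fun t =>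
    VectorMeasure.continuousAt_of_dominated (bound := fun _ => C) ?_ ?_ (integrable_const _) ?_
  · exact Eventually.of_forall fun t => (hf.indicator measurableSet_Ioo).aestronglyMeasurable
  · exact Eventually.of_forall fun t => Eventually.of_forall fun s =>
      (norm_indicator_le_norm_self _ _).trans (hC s)
  -- For `s ≠ t` the indicator of `Ioo 0 r` at `s` is constant for `r` near `t`; the exceptional
  -- point is null.
  · have : ∀ᵐ s ∂μ.variation, s ≠ t := by
      rw [ae_iff]
      simpa using hμ t
    filter_upwards [this] with s hs
    have hev : ∀ᶠ r in 𝓝 t, (s < r ↔ s < t) := by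
      rcases hs.lt_or_gt with h | h
      · filter_upwards [lt_mem_nhds h] with r hr
        exact ⟨fun _ => h, fun _ => hr⟩
      · filter_upwards [gt_mem_nhds h] with r hr
        exact ⟨fun h' => absurd h' hr.le.not_gt, fun h' => absurd h' h.le.not_gt⟩
    refine (continuousAt_const (y := Set.indicator (Set.Ioo 0 t) f s)).congr ?_
    filter_upwards [hev] with r hr
    classical
    simp only [Set.indicator_apply, Set.mem_Ioo, hr]

end MeasureTheory.SignedMeasure

/-! ### Integration by parts -/

/-- Splitting the square `A × A` along the diagonal, in terms of iterated integrals. -/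
theorem MeasureTheory.setIntegral_mul_setIntegral_eq_add (p q : Measure ℝ) [IsFiniteMeasure p]
    [IsFiniteMeasure q] (hq : ∀ a, q {a} = 0) {f g : ℝ → ℝ} (hf : Integrable f p)
    (hg : Integrable g q) (t : ℝ) :
    (∫ s in Set.Ioo 0 t, f s ∂p) * (∫ s in Set.Ioo 0 t, g s ∂q) =
      (∫ s in Set.Ioo 0 t, f s * (∫ r in Set.Ioo 0 s, g r ∂q) ∂p) +
      ∫ s in Set.Ioo 0 t, (∫ r in Set.Ioo 0 s, f r ∂p) * g s ∂q := by
  set P := p.restrict (Set.Ioo 0 t)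
  set Q := q.restrict (Set.Ioo 0 t)
  have hint : Integrable (fun z : ℝ × ℝ => f z.1 * g z.2) (P.prod Q) :=
    hf.restrict.mul_prod hg.restrict
  have hA : MeasurableSet {z : ℝ × ℝ | z.2 < z.1} := measurableSet_lt measurable_snd measurable_fst
  -- Each vertical fibre meets the diagonal in one point, so it is enough that `q` has no atoms.
  have hdiag : ∀ᵐ z ∂(P.prod Q), z.1 ≠ z.2 := by
    have hm : MeasurableSet {z : ℝ × ℝ | z.1 ≠ z.2} :=
      (measurableSet_eq_fun measurable_fst measurable_snd).compl
    rw [Measure.ae_prod_iff_ae_ae hm]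
    refine Eventually.of_forall fun x => ae_restrict_of_ae ?_
    rw [ae_iff]
    have : {a | ¬(x, a).1 ≠ (x, a).2} = {x} := by ext; simp [eq_comm]
    rw [this, hq]
  rw [← integral_prod_mul, ← integral_add_compl hA hint]
  congr 1
  · rw [← integral_indicator hA, integral_prod _ (hint.indicator hA)]
    refine setIntegral_congr_fun measurableSet_Ioo fun s hs => ?_
    rw [← integral_const_mul]
    have : (fun y => Set.indicator {z : ℝ × ℝ | z.2 < z.1} (fun z => f z.1 * g z.2) (s, y)) =
        Set.indicator (Set.Iio s) (fun y => f s * g y) := by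
      ext y; simp [Set.indicator_apply]
    rw [this, integral_indicator measurableSet_Iio, Measure.restrict_restrict measurableSet_Iio]
    congr 2
    ext y
    simp only [Set.mem_inter_iff, Set.mem_Iio, Set.mem_Ioo] at hs ⊢
    constructor
    · rintro ⟨h1, h2, _⟩; exact ⟨h2, h1⟩
    · rintro ⟨h1, h2⟩; exact ⟨h2, h1, h2.trans hs.2⟩
  · have hB : MeasurableSet {z : ℝ × ℝ | z.1 < z.2} :=
      measurableSet_lt measurable_fst measurable_snd
    have hAB : ({z : ℝ × ℝ | z.2 < z.1}ᶜ : Set (ℝ × ℝ)) =ᵐ[P.prod Q]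
        ({z : ℝ × ℝ | z.1 < z.2} : Set (ℝ × ℝ)) := by
      filter_upwards [hdiag] with z hz
      refine propext ?_
      change ¬ (z.2 < z.1) ↔ z.1 < z.2
      exact ⟨fun h => lt_of_le_of_ne (not_lt.1 h) hz, fun h => h.le.not_gt⟩
    rw [setIntegral_congr_set hAB, ← integral_indicator hB, integral_prod_symm _ (hint.indicator hB)]
    refine setIntegral_congr_fun measurableSet_Ioo fun s hs => ?_
    rw [← integral_mul_const]
    have : (fun y => Set.indicator {z : ℝ × ℝ | z.1 < z.2} (fun z => f z.1 * g z.2) (y, s)) =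
        Set.indicator (Set.Iio s) (fun y => f y * g s) := by
      ext y; simp [Set.indicator_apply]
    rw [this, integral_indicator measurableSet_Iio, Measure.restrict_restrict measurableSet_Iio]
    congr 2
    ext y
    simp only [Set.mem_inter_iff, Set.mem_Iio, Set.mem_Ioo] at hs ⊢
    constructor
    · rintro ⟨h1, h2, _⟩; exact ⟨h2, h1⟩
    · rintro ⟨h1, h2⟩; exact ⟨h2, h1, h2.trans hs.2⟩

theorem MeasureTheory.continuous_setIntegral_Ioo (p : Measure ℝ) [IsFiniteMeasure p]
    (hp : ∀ a, p {a} = 0) {f : ℝ → ℝ} (hf : Measurable f) {C : ℝ} (hC : ∀ x, |f x| ≤ C) :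
    Continuous fun t => ∫ s in Set.Ioo 0 t, f s ∂p := by
  have := SignedMeasure.continuous_setIntegral_Ioo p.toSignedMeasure
    (fun a => by rw [Measure.variation_toSignedMeasure, hp]) hf hC
  rw [ContinuousLinearMap.lsmul_real_eq_flip] at this
  simpa only [VectorMeasure.setIntegral_toSignedMeasure measurableSet_Ioo] using this

/-- Integration by parts for the indefinite integrals against atomless signed measures. -/
theorem MeasureTheory.SignedMeasure.setIntegral_mul_setIntegral_eq_add (μ ν : SignedMeasure ℝ)
    (hμ : ∀ a, μ.variation {a} = 0) (hν : ∀ a, ν.variation {a} = 0) {f g : ℝ → ℝ}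
    (hf : Measurable f) {C : ℝ} (hC : ∀ x, |f x| ≤ C)
    (hg : Measurable g) {D : ℝ} (hD : ∀ x, |g x| ≤ D) (t : ℝ) :
    (∫ᵛ s in Set.Ioo 0 t, f s ∂•μ) * (∫ᵛ s in Set.Ioo 0 t, g s ∂•ν) =
      (∫ᵛ s in Set.Ioo 0 t, f s * (∫ᵛ r in Set.Ioo 0 s, g r ∂•ν) ∂•μ) +
      ∫ᵛ s in Set.Ioo 0 t, (∫ᵛ r in Set.Ioo 0 s, f r ∂•μ) * g s ∂•ν := by
  have hC0 : 0 ≤ C := (abs_nonneg _).trans (hC 0)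
  have hD0 : 0 ≤ D := (abs_nonneg _).trans (hD 0)
  have hfG : μ.Integrable fun s => f s * (∫ᵛ r in Set.Ioo 0 s, g r ∂•ν) := by
    refine μ.integrable_of_bounded
      (hf.mul (ν.continuous_setIntegral_Ioo hν hg hD).measurable)
      (C := C * (D * ν.variation.real Set.univ)) fun s => ?_
    rw [abs_mul]
    exact mul_le_mul (hC s) (ν.abs_setIntegral_le hD0 hD) (abs_nonneg _) hC0
  have hFg : ν.Integrable fun s => (∫ᵛ r in Set.Ioo 0 s, f r ∂•μ) * g s := by
    refine ν.integrable_of_bounded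
      ((μ.continuous_setIntegral_Ioo hμ hf hC).measurable.mul hg)
      (C := (C * μ.variation.real Set.univ) * D) fun s => ?_
    rw [abs_mul]
    exact mul_le_mul (μ.abs_setIntegral_le hC0 hC) (hD s) (abs_nonneg _) (by positivity)
  have hfμ := μ.integrable_of_bounded hf hC
  have hgν := ν.integrable_of_bounded hg hD
  rw [μ.setIntegral_eq_sub measurableSet_Ioo hfG, ν.setIntegral_eq_sub measurableSet_Ioo hFg]
  simp_rw [μ.setIntegral_eq_sub measurableSet_Ioo hfμ, ν.setIntegral_eq_sub measurableSet_Ioo hgν]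
  have atomless {ρ : Measure ℝ} {κ : SignedMeasure ℝ} (h : ρ ≤ κ.variation)
      (hκ : ∀ a, κ.variation {a} = 0) (a : ℝ) : ρ {a} = 0 :=
    le_antisymm ((h _).trans (hκ a).le) zero_le
  set p := μ.toJordanDecomposition.posPart
  set n := μ.toJordanDecomposition.negPart
  set q := ν.toJordanDecomposition.posPart
  set m := ν.toJordanDecomposition.negPart
  have hp0 := atomless μ.posPart_le_variation hμ
  have hn0 := atomless μ.negPart_le_variation hμ
  have hq0 := atomless ν.posPart_le_variation hν
  have hm0 := atomless ν.negPart_le_variation hν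
  have I1 (ρ κ : Measure ℝ) [IsFiniteMeasure ρ] [IsFiniteMeasure κ] (hκ : ∀ a, κ {a} = 0) :
      IntegrableOn (fun s => f s * ∫ r in Set.Ioo 0 s, g r ∂κ) (Set.Ioo 0 t) ρ := by
    refine (Integrable.of_bound
      (hf.mul (MeasureTheory.continuous_setIntegral_Ioo κ hκ hg hD).measurable).aestronglyMeasurable
      (C * (D * κ.real Set.univ)) (Eventually.of_forall fun s => ?_)).integrableOn
    rw [Pi.mul_apply, norm_mul]
    refine mul_le_mul (hC s) ?_ (norm_nonneg _) hC0
    refine (norm_setIntegral_le_of_norm_le_const (measure_lt_top _ _) fun x _ => hD x).trans ?_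
    gcongr
    · finiteness
    · exact Set.subset_univ _
  have I2 (ρ κ : Measure ℝ) [IsFiniteMeasure ρ] [IsFiniteMeasure κ] (hκ : ∀ a, κ {a} = 0) :
      IntegrableOn (fun s => (∫ r in Set.Ioo 0 s, f r ∂κ) * g s) (Set.Ioo 0 t) ρ := by
    refine (Integrable.of_bound
      ((MeasureTheory.continuous_setIntegral_Ioo κ hκ hf hC).measurable.mul hg).aestronglyMeasurable
      ((C * κ.real Set.univ) * D) (Eventually.of_forall fun s => ?_)).integrableOn
    rw [Pi.mul_apply, norm_mul]
    refine mul_le_mul ?_ (hD s) (norm_nonneg _) (by positivity)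
    refine (norm_setIntegral_le_of_norm_le_const (measure_lt_top _ _) fun x _ => hC x).trans ?_
    gcongr
    · finiteness
    · exact Set.subset_univ _
  -- Bilinear expansion over the four pairs of positive and negative parts; the positive-measure
  -- identity applies to each pair.
  simp_rw [mul_sub, sub_mul]
  rw [integral_sub (I1 p q hq0) (I1 p m hm0), integral_sub (I1 n q hq0) (I1 n m hm0),
    integral_sub (I2 q p hp0) (I2 q n hn0), integral_sub (I2 m p hp0) (I2 m n hn0)]
  have fp : Integrable f p := hfμ.mono_measure μ.posPart_le_variation
  have fn : Integrable f n := hfμ.mono_measure μ.negPart_le_variation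
  have gq : Integrable g q := hgν.mono_measure ν.posPart_le_variation
  have gm : Integrable g m := hgν.mono_measure ν.negPart_le_variation
  rw [MeasureTheory.setIntegral_mul_setIntegral_eq_add p q hq0 fp gq,
    MeasureTheory.setIntegral_mul_setIntegral_eq_add n q hq0 fn gq,
    MeasureTheory.setIntegral_mul_setIntegral_eq_add p m hm0 fp gm,
    MeasureTheory.setIntegral_mul_setIntegral_eq_add n m hm0 fn gm]
  ring

/-! ### Stieltjes measures of continuous functions of bounded variation -/

namespace BoundedVariationOn

variable {f g : ℝ → ℝ}

theorem rightLim_eq_of_continuous (hc : Continuous f) (a : ℝ) : f.rightLim a = f a :=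
  rightLim_eq_of_tendsto (hc.tendsto a |>.mono_left nhdsWithin_le_nhds)

theorem leftLim_eq_of_continuous (hc : Continuous f) (a : ℝ) : f.leftLim a = f a :=
  leftLim_eq_of_tendsto (hc.tendsto a |>.mono_left nhdsWithin_le_nhds)

theorem vectorMeasure_Ioc_of_continuous (hf : BoundedVariationOn f Set.univ) (hc : Continuous f)
    {a b : ℝ} (h : a ≤ b) : hf.vectorMeasure (Set.Ioc a b) = f b - f a := by
  rw [hf.vectorMeasure_Ioc h, rightLim_eq_of_continuous hc, rightLim_eq_of_continuous hc]

theorem vectorMeasure_Ioo_of_continuous (hf : BoundedVariationOn f Set.univ) (hc : Continuous f)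
    {a b : ℝ} (h : a < b) : hf.vectorMeasure (Set.Ioo a b) = f b - f a := by
  rw [hf.vectorMeasure_Ioo h, rightLim_eq_of_continuous hc, leftLim_eq_of_continuous hc]

theorem variation_vectorMeasure_singleton (hf : BoundedVariationOn f Set.univ)
    (hc : Continuous f) (a : ℝ) : hf.vectorMeasure.variation {a} = 0 := by
  rw [VectorMeasure.variation_apply_eq_zero (measurableSet_singleton a)]
  intro t ht _
  rcases Set.subset_singleton_iff_eq.1 ht with rfl | rfl
  · simp
  · rw [hf.vectorMeasure_singleton, rightLim_eq_of_continuous hc, leftLim_eq_of_continuous hc,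
      sub_self]

theorem vectorMeasure_sub (hf : BoundedVariationOn f Set.univ) (hg : BoundedVariationOn g Set.univ)
    (hfg : BoundedVariationOn (fun t => f t - g t) Set.univ) (hfc : Continuous f)
    (hgc : Continuous g) : hfg.vectorMeasure = hf.vectorMeasure - hg.vectorMeasure := by
  refine SignedMeasure.ext_of_Ioc fun a b hab => ?_
  rw [sub_apply, hf.vectorMeasure_Ioc_of_continuous hfc hab.le,
    hg.vectorMeasure_Ioc_of_continuous hgc hab.le,
    hfg.vectorMeasure_Ioc_of_continuous (hfc.sub hgc) hab.le]
  ring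

/-- The total variation of the Stieltjes measure of `f` is at most the variation of `f`. -/
theorem variation_vectorMeasure_univ_le (hf : BoundedVariationOn f Set.univ)
    (hc : Continuous f) : hf.vectorMeasure.variation Set.univ ≤ eVariationOn f Set.univ := by
  have hr : f.rightLim = f := funext (rightLim_eq_of_continuous hc)
  -- The measure whose distribution function is the running variation of `f`: it dominates
  -- increments, and its total mass is at most the variation.
  set ν := (hf.stieltjesFunctionRightLim 0).measure
  have hν {a b : ℝ} (hab : a ≤ b) : ν (Set.Ioc a b) = eVariationOn f (Set.Icc a b) := by
    rw [StieltjesFunction.measure_Ioc, stieltjesFunctionRightLim_apply,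
      stieltjesFunctionRightLim_apply, hr,
      ← variationOnFromTo.add hf.locallyBoundedVariationOn (Set.mem_univ 0) (Set.mem_univ a)
        (Set.mem_univ b), add_sub_cancel_left, variationOnFromTo.eq_of_le _ _ hab,
      ENNReal.ofReal_toReal, Set.univ_inter]
    exact ne_top_of_le_ne_top hf (eVariationOn.mono _ (Set.subset_univ _))
  have huniv : ν Set.univ ≤ eVariationOn f Set.univ := by
    rw [← congrArg ν Real.iUnion_Ioc_neg_natCast, Real.monotone_Ioc_neg_natCast.measure_iUnion]
    refine iSup_le fun n => ?_
    rw [hν (neg_nonpos.2 n.cast_nonneg |>.trans n.cast_nonneg)]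
    exact eVariationOn.mono _ (Set.subset_univ _)
  have : IsFiniteMeasure ν := ⟨huniv.trans_lt hf.lt_top⟩
  refine (SignedMeasure.variation_le_of_Ioc (f := f) (ν := ν)
    (fun a b h => hf.vectorMeasure_Ioc_of_continuous hc h) (fun a b hab => ?_) _).trans huniv
  rw [hν hab, ← edist_eq_enorm_sub]
  exact eVariationOn.edist_le _ ⟨hab, le_rfl⟩ ⟨le_rfl, hab⟩

end BoundedVariationOn

/-! ### Continuity of the signature and the shuffle property -/

namespace BVPath

variable {n : ℕ}

theorem continuous_stopped (x : BVPath n) : Continuous x.stopped :=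
  x.toFun.continuous.Icc_extend'

theorem continuous_coord (x : BVPath n) (i : Fin n) : Continuous fun t => x.stopped t i :=
  (EuclideanSpace.proj (𝕜 := ℝ) i : EuclideanSpace ℝ (Fin n) →L[ℝ] ℝ).continuous.comp
    x.continuous_stopped

/-- The signed Stieltjes measure of the `i`-th coordinate of the stopped path. -/
noncomputable abbrev coordMeasure (x : BVPath n) (i : Fin n) : SignedMeasure ℝ :=
  (x.coord_boundedVariation i).vectorMeasure

theorem variation_coordMeasure_singleton (x : BVPath n) (i : Fin n) (a : ℝ) :
    (x.coordMeasure i).variation {a} = 0 :=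
  BoundedVariationOn.variation_vectorMeasure_singleton _ (x.continuous_coord i) a

theorem iteratedIntegral_zero (x : BVPath n) (I : Fin 0 → Fin n) (t : ℝ) :
    x.iteratedIntegral 0 I t = 1 := rfl

theorem iteratedIntegral_succ (x : BVPath n) {m : ℕ} (I : Fin (m + 1) → Fin n) (t : ℝ) :
    x.iteratedIntegral (m + 1) I t =
      ∫ᵛ s in Set.Ioo 0 t, x.iteratedIntegral m (Fin.init I) s ∂•x.coordMeasure (I (Fin.last m)) :=
  rfl

theorem iteratedIntegral_snoc (x : BVPath n) {m : ℕ} (I : Fin m → Fin n) (i : Fin n) (t : ℝ) :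
    x.iteratedIntegral (m + 1) (Fin.snoc I i : Fin (m + 1) → Fin n) t =
      ∫ᵛ s in Set.Ioo 0 t, x.iteratedIntegral m I s ∂•x.coordMeasure i := by
  rw [iteratedIntegral_succ, Fin.init_snoc, Fin.snoc_last]

/-- Absence of atoms gives continuity and finite variation gives boundedness. Both are proved
together because each integration needs a measurable bounded integrand. -/
theorem iteratedIntegral_continuous_and_bounded (x : BVPath n) : ∀ (m : ℕ) (I : Fin m → Fin n),
    Continuous (x.iteratedIntegral m I) ∧ ∃ C, ∀ t, |x.iteratedIntegral m I t| ≤ C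
  | 0, _ => ⟨continuous_const, 1, fun t => by simp [iteratedIntegral_zero]⟩
  | m + 1, I => by
    obtain ⟨hc, C, hC⟩ := x.iteratedIntegral_continuous_and_bounded m (Fin.init I)
    exact ⟨(x.coordMeasure (I (Fin.last m))).continuous_setIntegral_Ioo
      (x.variation_coordMeasure_singleton _) hc.measurable hC, _, fun t =>
      (x.coordMeasure (I (Fin.last m))).abs_setIntegral_le ((abs_nonneg _).trans (hC 0)) hC⟩

/-- The coordinate measures depend on the path in a `1`-Lipschitz way. -/
theorem variation_coordMeasure_sub_le (x y : BVPath n) (i : Fin n) :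
    (x.coordMeasure i - y.coordMeasure i).variation.real Set.univ ≤ dist x y := by
  have hle : eVariationOn (fun t => x.stopped t i - y.stopped t i) Set.univ ≤
      eVariationOn (fun t => x.stopped t - y.stopped t) Set.univ := by
    refine iSup_mono fun p => Finset.sum_le_sum fun k _ => ?_
    rw [edist_dist, edist_dist]
    refine ENNReal.ofReal_le_ofReal ?_
    rw [Real.dist_eq, dist_eq_norm, ← Real.norm_eq_abs]
    exact PiLp.norm_apply_le (x.stopped (p.2.1 (k + 1)) - y.stopped (p.2.1 (k + 1)) -
      (x.stopped (p.2.1 k) - y.stopped (p.2.1 k))) i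
  have hbv : BoundedVariationOn (fun t => x.stopped t i - y.stopped t i) Set.univ :=
    ne_top_of_le_ne_top (sub_boundedVariation x y) hle
  rw [coordMeasure, coordMeasure, ← BoundedVariationOn.vectorMeasure_sub _ _ hbv
    (x.continuous_coord i) (y.continuous_coord i)]
  calc _ ≤ (eVariationOn (fun t => x.stopped t - y.stopped t) Set.univ).toReal :=
        ENNReal.toReal_mono (sub_boundedVariation x y) ((hbv.variation_vectorMeasure_univ_le
          ((x.continuous_coord i).sub (y.continuous_coord i))).trans hle)
    _ ≤ _ := le_add_of_nonneg_left (abs_nonneg _)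

/-- With `u`, `v` the inner integrals along `x`, `y`, split `∫ u dx - ∫ v dy` as `∫ (u - v) dx + ∫ v
d(x - y)`. Induction controls the first term, the metric the second. -/
theorem tendstoUniformly_iteratedIntegral (y : BVPath n) : ∀ (m : ℕ) (I : Fin m → Fin n),
    TendstoUniformly (fun x => iteratedIntegral x m I) (y.iteratedIntegral m I) (𝓝 y)
  | 0, _ => by
    rw [Metric.tendstoUniformly_iff]
    intro ε hε
    exact Eventually.of_forall fun x t => by simpa [iteratedIntegral_zero] using hε
  | m + 1, I => by
    have ih := Metric.tendstoUniformly_iff.1 (y.tendstoUniformly_iteratedIntegral m (Fin.init I))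
    rw [Metric.tendstoUniformly_iff]
    intro ε hε
    obtain ⟨hcy, C, hC⟩ := y.iteratedIntegral_continuous_and_bounded m (Fin.init I)
    have hC0 : 0 ≤ C := (abs_nonneg _).trans (hC 0)
    set i := I (Fin.last m)
    set V := (y.coordMeasure i).variation.real Set.univ
    have hV : 0 ≤ V := measureReal_nonneg
    -- The two terms are at most `δ * (V + 1)` and `C * δ`: `V + 1` bounds the variation of the
    -- measure of `x` once `dist x y < 1`. The surplus makes the final inequality strict.
    set δ := ε / (2 * (V + 1 + C + 1))
    have hδ : 0 < δ := by positivity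
    filter_upwards [ih δ hδ, Metric.ball_mem_nhds y (lt_min one_pos hδ)] with x hx hxy t
    have hd : dist x y < min 1 δ := hxy
    obtain ⟨hcx, D, hD⟩ := x.iteratedIntegral_continuous_and_bounded m (Fin.init I)
    have iyy := (y.coordMeasure i).integrable_of_bounded hcy.measurable hC
    have iyx := (x.coordMeasure i).integrable_of_bounded hcy.measurable hC
    have ixx := (x.coordMeasure i).integrable_of_bounded hcx.measurable hD
    have hsplit : x.iteratedIntegral (m + 1) I t - y.iteratedIntegral (m + 1) I t =
        (∫ᵛ s in Set.Ioo 0 t, (x.iteratedIntegral m (Fin.init I) s -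
          y.iteratedIntegral m (Fin.init I) s) ∂•x.coordMeasure i) +
        ∫ᵛ s in Set.Ioo 0 t, y.iteratedIntegral m (Fin.init I) s
          ∂•(x.coordMeasure i - y.coordMeasure i) := by
      rw [VectorMeasure.integral_fun_sub ixx.restrict iyx.restrict,
        VectorMeasure.restrict_sub,
        VectorMeasure.integral_sub_vectorMeasure iyx.restrict iyy.restrict]
      rw [iteratedIntegral_succ, iteratedIntegral_succ]
      ring
    have h1 : |∫ᵛ s in Set.Ioo 0 t, (x.iteratedIntegral m (Fin.init I) s -
          y.iteratedIntegral m (Fin.init I) s) ∂•x.coordMeasure i| ≤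
        δ * (x.coordMeasure i).variation.real Set.univ := by
      refine (x.coordMeasure i).abs_setIntegral_le hδ.le fun s => ?_
      have := (hx s).le
      rwa [dist_comm, Real.dist_eq] at this
    have h2 : |∫ᵛ s in Set.Ioo 0 t, y.iteratedIntegral m (Fin.init I) s
          ∂•(x.coordMeasure i - y.coordMeasure i)| ≤ C * dist x y :=
      ((x.coordMeasure i - y.coordMeasure i).abs_setIntegral_le hC0 hC).trans
        (by gcongr; exact variation_coordMeasure_sub_le x y i)
    have h3 : (x.coordMeasure i).variation.real Set.univ ≤ V + 1 := by
      have e : x.coordMeasure i = y.coordMeasure i + (x.coordMeasure i - y.coordMeasure i) := by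
        abel
      have : (x.coordMeasure i).variation.real Set.univ ≤
          V + (x.coordMeasure i - y.coordMeasure i).variation.real Set.univ := by
        rw [← measureReal_add_apply]
        conv_lhs => rw [e]
        exact ENNReal.toReal_mono (measure_ne_top _ _) (VectorMeasure.variation_add_le _)
      linarith [variation_coordMeasure_sub_le x y i, min_le_left (1 : ℝ) δ]
    rw [dist_comm, Real.dist_eq, hsplit]
    calc _ ≤ δ * (V + 1) + C * δ := (abs_add_le _ _).trans (add_le_add
          (h1.trans (by gcongr)) (h2.trans (by gcongr; exact hd.le.trans (min_le_right _ _))))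
      _ < 2 * (V + 1 + C + 1) * δ := by nlinarith
      _ = ε := by simp only [δ]; field_simp

theorem continuous_T : Continuous (T : BVPath n → ℝ) := by
  refine (LipschitzWith.of_dist_le_mul (K := 1) fun x y => ?_).continuous
  rw [NNReal.coe_one, one_mul]
  exact le_add_of_nonneg_right ENNReal.toReal_nonneg

/-- The evaluation time `T` moves with the path, which is why convergence uniform in time is needed.
-/
theorem continuous_signature (m : ℕ) (I : Fin m → Fin n) :
    Continuous fun x : BVPath n => x.signature m I := by
  refine continuous_iff_continuousAt.2 fun y => ?_
  refine tendsto_comp_of_locally_uniform_limit (F := fun x : BVPath n => x.iteratedIntegral m I)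
    (f := y.iteratedIntegral m I) (g := T)
    (y.iteratedIntegral_continuous_and_bounded m I).1.continuousAt continuous_T.continuousAt
    fun u hu => ⟨Set.univ, univ_mem, ?_⟩
  filter_upwards [y.tendstoUniformly_iteratedIntegral m I u hu] with x hx t _ using hx t

/-- The linear span of the iterated integrals, as functionals of the path and of the time. -/
noncomputable def iteratedIntegralSpan (n : ℕ) : Submodule ℝ (BVPath n → ℝ → ℝ) :=
  Submodule.span ℝ (Set.range fun (I : Σ m : ℕ, (Fin m → Fin n)) (x : BVPath n) (t : ℝ) =>
    x.iteratedIntegral I.1 I.2 t)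

theorem iteratedIntegral_mem_span (m : ℕ) (I : Fin m → Fin n) :
    (fun (x : BVPath n) (t : ℝ) => x.iteratedIntegral m I t) ∈ iteratedIntegralSpan n :=
  Submodule.subset_span ⟨⟨m, I⟩, rfl⟩

theorem continuous_and_bounded_of_mem_span {φ : BVPath n → ℝ → ℝ}
    (hφ : φ ∈ iteratedIntegralSpan n) (x : BVPath n) :
    Continuous (φ x) ∧ ∃ C, ∀ t, |φ x t| ≤ C := by
  induction hφ using Submodule.span_induction with
  | mem φ h =>
    obtain ⟨I, rfl⟩ := h
    exact x.iteratedIntegral_continuous_and_bounded I.1 I.2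
  | zero => exact ⟨continuous_const, 0, fun t => by simp⟩
  | add φ ψ _ _ h1 h2 =>
    obtain ⟨c1, C, hC⟩ := h1
    obtain ⟨c2, D, hD⟩ := h2
    exact ⟨c1.add c2, C + D, fun t => (abs_add_le _ _).trans (add_le_add (hC t) (hD t))⟩
  | smul a φ _ h =>
    obtain ⟨c1, C, hC⟩ := h
    refine ⟨c1.const_smul a, |a| * C, fun t => ?_⟩
    rw [Pi.smul_apply, Pi.smul_apply, smul_eq_mul, abs_mul]
    exact mul_le_mul_of_nonneg_left (hC t) (abs_nonneg _)

theorem integrable_of_mem_span {φ : BVPath n → ℝ → ℝ}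
    (hφ : φ ∈ iteratedIntegralSpan n) (x : BVPath n) (i : Fin n) :
    (x.coordMeasure i).Integrable (φ x) := by
  obtain ⟨hc, C, hC⟩ := continuous_and_bounded_of_mem_span hφ x
  exact (x.coordMeasure i).integrable_of_bounded hc.measurable hC

/-- Integrating against coordinate `i` appends the letter `i` to every word; the rest is linearity.
-/
theorem setIntegral_mem_span {φ : BVPath n → ℝ → ℝ} (hφ : φ ∈ iteratedIntegralSpan n)
    (i : Fin n) :
    (fun (x : BVPath n) (t : ℝ) => ∫ᵛ s in Set.Ioo 0 t, φ x s ∂•x.coordMeasure i) ∈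
      iteratedIntegralSpan n := by
  induction hφ using Submodule.span_induction with
  | mem φ h =>
    obtain ⟨I, rfl⟩ := h
    simpa only [iteratedIntegral_snoc] using
      iteratedIntegral_mem_span (I.1 + 1) (Fin.snoc I.2 i : Fin (I.1 + 1) → Fin n)
  | zero =>
    convert (iteratedIntegralSpan n).zero_mem using 1
    ext x t
    exact VectorMeasure.integral_zero
  | add φ ψ h1 h2 i1 i2 =>
    convert (iteratedIntegralSpan n).add_mem i1 i2 using 1
    ext x t
    exact VectorMeasure.integral_fun_add (integrable_of_mem_span h1 x i).restrict
      (integrable_of_mem_span h2 x i).restrict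
  | smul a φ _ h =>
    convert (iteratedIntegralSpan n).smul_mem a h using 1
    ext x t
    exact VectorMeasure.integral_fun_smul _ _ a (φ x)

/-- Integration by parts makes either the last letter of `I` or that of `J` outermost, leaving under
the integral a product of total length one less. Hence the induction on `N`, ending when a word is
empty. -/
theorem iteratedIntegral_mul_mem_span : ∀ (N m k : ℕ), m + k = N → ∀ (I : Fin m → Fin n)
    (J : Fin k → Fin n), (fun (x : BVPath n) (t : ℝ) =>
      x.iteratedIntegral m I t * x.iteratedIntegral k J t) ∈ iteratedIntegralSpan n
  | _, 0, k, _, I, J => by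
    simpa only [iteratedIntegral_zero, one_mul] using iteratedIntegral_mem_span k J
  | _, m, 0, _, I, J => by
    simpa only [iteratedIntegral_zero, mul_one] using iteratedIntegral_mem_span m I
  | N + 1, m + 1, k + 1, h, I, J => by
    have h1 := setIntegral_mem_span (iteratedIntegral_mul_mem_span N m (k + 1) (by lia)
      (Fin.init I) J) (I (Fin.last m))
    have h2 := setIntegral_mem_span (iteratedIntegral_mul_mem_span N (m + 1) k (by lia)
      I (Fin.init J)) (J (Fin.last k))
    convert (iteratedIntegralSpan n).add_mem h1 h2 using 1
    ext x t
    obtain ⟨hcI, C, hC⟩ := x.iteratedIntegral_continuous_and_bounded m (Fin.init I)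
    obtain ⟨hcJ, D, hD⟩ := x.iteratedIntegral_continuous_and_bounded k (Fin.init J)
    exact SignedMeasure.setIntegral_mul_setIntegral_eq_add _ _
      (x.variation_coordMeasure_singleton _) (x.variation_coordMeasure_singleton _)
      hcI.measurable hC hcJ.measurable hD t

/-- The shuffle property: products of iterated integrals are linear combinations of iterated
integrals. -/
theorem mul_mem_span {φ ψ : BVPath n → ℝ → ℝ} (hφ : φ ∈ iteratedIntegralSpan n)
    (hψ : ψ ∈ iteratedIntegralSpan n) : φ * ψ ∈ iteratedIntegralSpan n := by
  have h := Submodule.mul_mem_mul hφ hψ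
  rw [iteratedIntegralSpan, Submodule.span_mul_span] at h
  refine Submodule.span_le.2 ?_ h
  rintro _ ⟨_, ⟨I, rfl⟩, _, ⟨J, rfl⟩, rfl⟩
  exact iteratedIntegral_mul_mem_span _ _ _ rfl I.2 J.2

theorem one_mem_span : (1 : BVPath n → ℝ → ℝ) ∈ iteratedIntegralSpan n :=
  iteratedIntegral_mem_span 0 Fin.elim0

theorem exists_pairing_eq {φ : BVPath n → ℝ → ℝ} (hφ : φ ∈ iteratedIntegralSpan n) :
    ∃ w : (Σ m : ℕ, (Fin m → Fin n)) →₀ ℝ, ∀ x, pairing w x = φ x x.T := by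
  obtain ⟨w, rfl⟩ := Finsupp.mem_span_range_iff_exists_finsupp.1 hφ
  refine ⟨w, fun x => ?_⟩
  simp only [pairing, Finsupp.sum, Finset.sum_apply, Pi.smul_apply, smul_eq_mul, signature]

end BVPath

/-! ### Two tools from real analysis: variation of monotone functions, and the moment problem -/

theorem Monotone.eVariationOn_univ_le {f : ℝ → ℝ} (hf : Monotone f) {a b : ℝ}
    (ha : ∀ t, a ≤ f t) (hb : ∀ t, f t ≤ b) :
    eVariationOn f Set.univ ≤ ENNReal.ofReal (b - a) := by
  refine iSup_le fun p => ?_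
  have h (i : ℕ) : 0 ≤ f (p.2.1 (i + 1)) - f (p.2.1 i) :=
    sub_nonneg.2 (hf (p.2.2.1 i.le_succ))
  calc _ = ∑ i ∈ Finset.range p.1, ENNReal.ofReal (f (p.2.1 (i + 1)) - f (p.2.1 i)) :=
        Finset.sum_congr rfl fun i _ => by rw [edist_dist, Real.dist_eq, abs_of_nonneg (h i)]
    _ = ENNReal.ofReal (f (p.2.1 p.1) - f (p.2.1 0)) := by
        rw [← ENNReal.ofReal_sum_of_nonneg fun i _ => h i,
          Finset.sum_range_sub fun i => f (p.2.1 i)]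
    _ ≤ _ := ENNReal.ofReal_le_ofReal (sub_le_sub (hb _) (ha _))

/-- A continuous function all of whose moments on `[0, T]` vanish is zero on `[0, T]`. -/
theorem eqOn_zero_of_moments_eq_zero {h : ℝ → ℝ} (hc : Continuous h) {T : ℝ} (hT : 0 < T)
    (hm : ∀ k : ℕ, ∫ s in (0 : ℝ)..T, h s * s ^ k = 0) : Set.EqOn h 0 (Set.Icc 0 T) := by
  have hp (p : Polynomial ℝ) : ∫ s in (0 : ℝ)..T, h s * p.eval s = 0 := by
    induction p using Polynomial.induction_on' with
    | add p q hp hq =>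
      simp_rw [Polynomial.eval_add, mul_add]
      rw [intervalIntegral.integral_add, hp, hq, add_zero] <;>
        exact Continuous.intervalIntegrable (by fun_prop) _ _
    | monomial k a =>
      simp_rw [Polynomial.eval_monomial, mul_left_comm]
      rw [intervalIntegral.integral_const_mul, hm, mul_zero]
  obtain ⟨M, hM⟩ : ∃ M, ∀ s ∈ Set.Icc 0 T, |h s| ≤ M :=
    isCompact_Icc.exists_bound_of_continuousOn hc.continuousOn
  have hM0 : 0 ≤ M := (abs_nonneg _).trans (hM 0 ⟨le_rfl, hT.le⟩)
  -- `h` is orthogonal to polynomials, so subtracting a Weierstrass approximation from one factor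
  -- does not change `∫ h²`.
  have hle (ε : ℝ) (hε : 0 < ε) : ∫ s in (0 : ℝ)..T, h s * h s ≤ M * ε * T := by
    obtain ⟨p, hpε⟩ := exists_polynomial_near_of_continuousOn 0 T h hc.continuousOn ε hε
    have e : ∫ s in (0 : ℝ)..T, h s * h s = ∫ s in (0 : ℝ)..T, h s * (h s - p.eval s) := by
      simp_rw [mul_sub]
      rw [intervalIntegral.integral_sub, hp, sub_zero] <;>
        exact Continuous.intervalIntegrable (by fun_prop) _ _
    rw [e]
    have := intervalIntegral.norm_integral_le_of_norm_le_const (a := 0) (b := T)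
      (f := fun s => h s * (h s - p.eval s)) (C := M * ε) fun s hs => by
        rw [Set.uIoc_of_le hT.le] at hs
        have hs' : s ∈ Set.Icc 0 T := ⟨hs.1.le, hs.2⟩
        rw [norm_mul]
        refine mul_le_mul (hM s hs') ?_ (norm_nonneg _) hM0
        rw [norm_sub_rev]
        exact (hpε s hs').le
    rw [sub_zero, abs_of_pos hT] at this
    exact (le_abs_self _).trans this
  have hzero : ∫ s in (0 : ℝ)..T, h s * h s = 0 := by
    refine le_antisymm (le_of_forall_pos_le_add fun ε hε => ?_)
      (intervalIntegral.integral_nonneg hT.le fun s _ => mul_self_nonneg _)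
    rw [zero_add]
    refine (hle (ε / (M * T + 1)) (by positivity)).trans ?_
    rw [mul_right_comm, mul_div_assoc', div_le_iff₀ (by positivity)]
    nlinarith [mul_nonneg hM0 hT.le]
  by_contra hne
  simp only [Set.EqOn, not_forall] at hne
  obtain ⟨t, ht, hht⟩ := hne
  have := intervalIntegral.integral_pos (f := fun s => h s * h s) hT
    (hc.mul hc).continuousOn (fun s _ => mul_self_nonneg _)
    ⟨t, ht, mul_self_pos.2 hht⟩
  linarith

/-! ### Time augmentation, and recovery of the path from its signature -/

namespace BVPath

variable {n : ℕ}

theorem stopped_timeAugment_zero (x : BVPath n) (t : ℝ) :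
    x.timeAugment.stopped t 0 = max 0 (min x.T t) := rfl

theorem stopped_timeAugment_succ (x : BVPath n) (t : ℝ) (j : Fin n) :
    x.timeAugment.stopped t j.succ = x.stopped t j := rfl

/-- The stopped clocks differ by a monotone function with total increase `|x.T - y.T|`. So this
difference is counted once as an end-time gap and once as variation, whence the factor 2. -/
theorem dist_timeAugment_le (x y : BVPath n) : dist x.timeAugment y.timeAugment ≤ 2 * dist x y := by
  wlog hle : y.T ≤ x.T generalizing x y
  · rw [dist_comm, dist_comm x]
    exact this y x (le_of_not_ge hle)
  have hy := y.T_pos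
  -- Time clamped to `[y.T, x.T]`: up to the constant `y.T`, the difference of the two stopped
  -- clocks.
  set c : ℝ → ℝ := fun t => max y.T (min x.T t)
  have hcv : eVariationOn c Set.univ ≤ ENNReal.ofReal |x.T - y.T| := by
    rw [abs_of_nonneg (sub_nonneg.2 hle)]
    exact Monotone.eVariationOn_univ_le (fun a b h => max_le_max le_rfl (min_le_min le_rfl h))
      (fun t => le_max_left _ _) fun t => max_le hle (min_le_left _ _)
  have hclamp (t : ℝ) : max 0 (min x.T t) - max 0 (min y.T t) = c t - y.T := by
    simp only [c]
    grind
  have hv : eVariationOn (fun t => x.timeAugment.stopped t - y.timeAugment.stopped t) Set.univ ≤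
      eVariationOn c Set.univ + eVariationOn (fun t => x.stopped t - y.stopped t) Set.univ := by
    refine eVariationOn_le_add_of_edist_le fun a b => ?_
    rw [edist_dist, edist_dist, edist_dist, ← ENNReal.ofReal_add dist_nonneg dist_nonneg]
    refine ENNReal.ofReal_le_ofReal ?_
    rw [EuclideanSpace.dist_eq, EuclideanSpace.dist_eq, Fin.sum_univ_succ]
    simp only [PiLp.sub_apply, stopped_timeAugment_zero, stopped_timeAugment_succ, hclamp,
      dist_sub_right]
    set S := ∑ i, dist (x.stopped a i - y.stopped a i) (x.stopped b i - y.stopped b i) ^ 2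
    have hS : 0 ≤ S := Finset.sum_nonneg fun _ _ => sq_nonneg _
    rw [Real.sqrt_le_iff]
    refine ⟨by positivity, ?_⟩
    nlinarith [Real.sq_sqrt hS, Real.sqrt_nonneg S, dist_nonneg (x := c a) (y := c b)]
  have hfin := sub_boundedVariation x y
  have hreal : (eVariationOn (fun t => x.timeAugment.stopped t - y.timeAugment.stopped t)
      Set.univ).toReal ≤ |x.T - y.T| +
        (eVariationOn (fun t => x.stopped t - y.stopped t) Set.univ).toReal := by
    refine (ENNReal.toReal_mono (ENNReal.add_ne_top.2 ⟨ENNReal.ofReal_ne_top, hfin⟩)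
      (hv.trans (add_le_add_left hcv _))).trans_eq ?_
    rw [ENNReal.toReal_add ENNReal.ofReal_ne_top hfin, ENNReal.toReal_ofReal (abs_nonneg _)]
  have e1 : dist x.timeAugment y.timeAugment = |x.T - y.T| +
      (eVariationOn (fun t => x.timeAugment.stopped t - y.timeAugment.stopped t)
        Set.univ).toReal := rfl
  have e2 : dist x y = |x.T - y.T| +
      (eVariationOn (fun t => x.stopped t - y.stopped t) Set.univ).toReal := rfl
  have h0 : 0 ≤ (eVariationOn (fun t => x.stopped t - y.stopped t) Set.univ).toReal :=
    ENNReal.toReal_nonneg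
  rw [e1, e2]
  linarith

theorem continuous_timeAugment : Continuous (timeAugment : BVPath n → BVPath (n + 1)) :=
  (LipschitzWith.of_dist_le_mul (K := 2) fun x y => by
    simpa using dist_timeAugment_le x y).continuous

/-- The stopped clock has slope one on `[0, T]` and is constant elsewhere. This turns integrals
against the time letter into Lebesgue integrals. -/
theorem coordMeasure_timeAugment_zero (x : BVPath n) :
    x.timeAugment.coordMeasure 0 = (volume.restrict (Set.Ioc 0 x.T)).toSignedMeasure := by
  refine SignedMeasure.ext_of_Ioc fun a b hab => ?_
  have hx := x.T_pos
  rw [coordMeasure, BoundedVariationOn.vectorMeasure_Ioc_of_continuous _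
    (x.timeAugment.continuous_coord 0) hab.le, stopped_timeAugment_zero, stopped_timeAugment_zero,
    Measure.toSignedMeasure_apply_measurable measurableSet_Ioc,
    measureReal_restrict_apply measurableSet_Ioc, Set.Ioc_inter_Ioc, measureReal_def,
    Real.volume_Ioc, ENNReal.toReal_ofReal']
  simp only [max_def, min_def]
  grind

theorem iteratedIntegral_one (x : BVPath n) (I : Fin 1 → Fin n) {t : ℝ} (ht : 0 < t) :
    x.iteratedIntegral 1 I t = x.stopped t (I 0) := by
  rw [iteratedIntegral_succ]
  change ∫ᵛ _ in Set.Ioo 0 t, (1 : ℝ) ∂•x.coordMeasure (I 0) = _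
  rw [VectorMeasure.setIntegral_const,
    BoundedVariationOn.vectorMeasure_Ioo_of_continuous _ (x.continuous_coord _) ht, stopped_zero]
  simp

theorem eq_of_stopped_eq {x y : BVPath n} (hT : x.T = y.T)
    (h : ∀ t ∈ Set.Icc 0 x.T, x.stopped t = y.stopped t) : x = y := by
  obtain ⟨T, hT0, f, hf, hf0⟩ := x
  obtain ⟨T', hT0', g, hg, hg0⟩ := y
  obtain rfl : T = T' := hT
  obtain rfl : f = g := by
    ext1 t
    simpa [stopped, Set.IccExtend_of_mem _ _ t.2] using h t t.2
  rfl

/-- The signature of a time-augmented path determines the path. -/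
theorem eq_of_forall_mem_span_eq {x y : BVPath n}
    (h : ∀ φ ∈ iteratedIntegralSpan (n + 1),
      φ x.timeAugment x.timeAugment.T = φ y.timeAugment y.timeAugment.T) : x = y := by
  have hT : x.T = y.T := by
    have := h _ (iteratedIntegral_mem_span 1 fun _ => 0)
    rw [iteratedIntegral_one _ _ x.timeAugment.T_pos, iteratedIntegral_one _ _ y.timeAugment.T_pos,
      stopped_timeAugment_zero, stopped_timeAugment_zero] at this
    change max 0 (min x.T x.T) = max 0 (min y.T y.T) at this
    rwa [min_self, min_self, max_eq_right x.T_pos.le, max_eq_right y.T_pos.le] at this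
  -- Both `zʲ(s)` and `s` are words of length one, so `zʲ(s) sᵏ` is in the span by the shuffle
  -- property; one more integration, against time, gives the moment.
  have hmoment (j : Fin n) (k : ℕ) : ∃ φ ∈ iteratedIntegralSpan (n + 1), ∀ z : BVPath n,
      φ z.timeAugment z.timeAugment.T = ∫ s in (0 : ℝ)..z.T, z.stopped s j * s ^ k := by
    have hpow : ∀ k : ℕ, (fun (z : BVPath (n + 1)) t => z.iteratedIntegral 1 (fun _ => 0) t) ^ k ∈
        iteratedIntegralSpan (n + 1) := by
      intro k
      induction k with
      | zero => simpa using one_mem_span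
      | succ k ih =>
        rw [pow_succ]
        exact mul_mem_span ih (iteratedIntegral_mem_span _ _)
    refine ⟨_, setIntegral_mem_span
      (mul_mem_span (iteratedIntegral_mem_span 1 fun _ => j.succ) (hpow k)) 0, fun z => ?_⟩
    change ∫ᵛ s in Set.Ioo 0 z.T, _ ∂•_ = _
    rw [coordMeasure_timeAugment_zero, ContinuousLinearMap.lsmul_real_eq_flip,
      VectorMeasure.setIntegral_toSignedMeasure measurableSet_Ioo,
      Measure.restrict_restrict measurableSet_Ioo,
      Set.inter_eq_left.2 Set.Ioo_subset_Ioc_self,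
      intervalIntegral.integral_of_le z.T_pos.le, integral_Ioc_eq_integral_Ioo]
    refine setIntegral_congr_fun measurableSet_Ioo fun s hs => ?_
    simp only [Pi.mul_apply, Pi.pow_apply]
    rw [iteratedIntegral_one _ _ hs.1, iteratedIntegral_one _ _ hs.1, stopped_timeAugment_zero,
      stopped_timeAugment_succ, min_eq_right hs.2.le, max_eq_right hs.1.le]
  refine eq_of_stopped_eq hT fun t ht => ?_
  ext j
  have hcx := x.continuous_coord j
  have hcy := y.continuous_coord j
  have hm (k : ℕ) : ∫ s in (0 : ℝ)..x.T, (x.stopped s j - y.stopped s j) * s ^ k = 0 := by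
    obtain ⟨φ, hφ, e⟩ := hmoment j k
    have hxy := h φ hφ
    rw [e, e, ← hT] at hxy
    simp_rw [sub_mul]
    exact (intervalIntegral.integral_sub ((hcx.mul (continuous_pow k)).intervalIntegrable _ _)
      ((hcy.mul (continuous_pow k)).intervalIntegrable _ _)).trans (sub_eq_zero.2 hxy)
  exact sub_eq_zero.1 (eqOn_zero_of_moments_eq_zero (hcx.sub hcy) x.T_pos hm ht)

end BVPath

/-! ### Stone–Weierstrass and expected signatures -/

namespace BVPath

variable {n : ℕ}

theorem continuous_pairing (w : (Σ m : ℕ, (Fin m → Fin n)) →₀ ℝ) :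
    Continuous (pairing w : BVPath n → ℝ) :=
  continuous_finsetSum _ fun I _ => continuous_const.mul (continuous_signature I.1 I.2)

theorem continuous_augmentOn (K : Set (BVPath n)) : Continuous (augmentOn K) :=
  (continuous_timeAugment.comp continuous_subtype_val).subtype_mk _

/-- The algebra of linear functionals of the signature, on a set of paths. -/
noncomputable def signatureSubalgebra (L : Set (BVPath n)) : Subalgebra ℝ C(L, ℝ) where
  carrier := {g | ∃ φ ∈ iteratedIntegralSpan n, ∀ x : L, g x = φ x (x : BVPath n).T}
  mul_mem' := by
    rintro f g ⟨φ, hφ, hf⟩ ⟨ψ, hψ, hg⟩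
    exact ⟨φ * ψ, mul_mem_span hφ hψ, fun x => by simp [hf, hg]⟩
  add_mem' := by
    rintro f g ⟨φ, hφ, hf⟩ ⟨ψ, hψ, hg⟩
    exact ⟨φ + ψ, add_mem hφ hψ, fun x => by simp [hf, hg]⟩
  algebraMap_mem' r :=
    ⟨r • 1, Submodule.smul_mem _ r one_mem_span, fun x => by simp⟩

theorem mem_signatureSubalgebra {L : Set (BVPath n)} {φ : BVPath n → ℝ → ℝ}
    (hφ : φ ∈ iteratedIntegralSpan n) :
    ∃ g ∈ signatureSubalgebra L, ∀ x : L, g x = φ x (x : BVPath n).T := by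
  obtain ⟨w, hw⟩ := exists_pairing_eq hφ
  exact ⟨⟨fun x => pairing w x, (continuous_pairing w).comp continuous_subtype_val⟩,
    ⟨φ, hφ, fun x => hw x⟩, fun x => hw x⟩

theorem signatureSubalgebra_separatesPoints (K : Set (BVPath n)) :
    (signatureSubalgebra (timeAugment '' K)).SeparatesPoints := by
  rintro ⟨_, x, hx, rfl⟩ ⟨_, y, hy, rfl⟩ hne
  by_contra hcon
  refine hne (Subtype.ext (congrArg timeAugment (eq_of_forall_mem_span_eq fun φ hφ => ?_)))
  obtain ⟨g, hg, hgφ⟩ := mem_signatureSubalgebra (L := timeAugment '' K) hφ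
  by_contra h
  refine hcon ⟨g, ⟨g, hg, rfl⟩, ?_⟩
  rwa [hgφ, hgφ]

/-- Universality: linear functionals of the signature approximate any continuous function on a
compact set of time-augmented paths. -/
theorem exists_pairing_near {K : Set (BVPath n)} (hK : IsCompact K)
    (f : (timeAugment '' K) →ᵇ ℝ) {ε : ℝ} (hε : 0 < ε) :
    ∃ w : (Σ m : ℕ, (Fin m → Fin (n + 1))) →₀ ℝ, ∀ x : timeAugment '' K,
      |f x - pairing w x| < ε := by
  have : CompactSpace (timeAugment '' K) :=
    isCompact_iff_compactSpace.1 (hK.image continuous_timeAugment)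
  obtain ⟨⟨g, φ, hφ, hg⟩, hgε⟩ :=
    ContinuousMap.exists_mem_subalgebra_near_continuous_of_separatesPoints
      (signatureSubalgebra (timeAugment '' K)) (signatureSubalgebra_separatesPoints K) f
      f.continuous ε hε
  obtain ⟨w, hw⟩ := exists_pairing_eq hφ
  refine ⟨w, fun x => ?_⟩
  rw [hw, ← hg, ← Real.norm_eq_abs, norm_sub_rev]
  exact hgε x

section Expectation

variable {K : Set (BVPath n)} {Ω : Type*} [MeasurableSpace Ω] {P : Measure Ω}
  [IsProbabilityMeasure P] {X : Ω → K}

theorem integrable_comp_of_continuous (hK : IsCompact K) {g : BVPath n → ℝ} (hg : Continuous g)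
    (hX : Measurable X) : Integrable (fun ω => g (X ω)) P := by
  obtain ⟨C, hC⟩ := hK.exists_bound_of_continuousOn hg.continuousOn
  exact Integrable.of_bound
    (hg.measurable.comp (measurable_subtype_coe.comp hX)).aestronglyMeasurable C
    (Eventually.of_forall fun ω => hC _ (X ω).2)

theorem integrable_signature (hK : IsCompact K) (hX : Measurable X) (m : ℕ) :
    Integrable (fun ω => (timeAugment (X ω : BVPath n)).signature m) P :=
  Integrable.of_eval fun I => integrable_comp_of_continuous hK
    ((continuous_signature m I).comp continuous_timeAugment) hX

theorem integral_signature_apply (hK : IsCompact K) (hX : Measurable X) (m : ℕ)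
    (I : Fin m → Fin (n + 1)) :
    (∫ ω, (timeAugment (X ω : BVPath n)).signature m ∂P) I =
      ∫ ω, (timeAugment (X ω : BVPath n)).signature m I ∂P :=
  eval_integral (fun I => (integrable_signature hK hX m).eval I) I

/-- Linear functionals of the signature see a law only through its expected signature; compactness
supplies the integrability needed to exchange sum and expectation. -/
theorem integral_pairing (hK : IsCompact K) (hX : Measurable X)
    (w : (Σ m : ℕ, (Fin m → Fin (n + 1))) →₀ ℝ) :
    ∫ ω, pairing w (timeAugment (X ω : BVPath n)) ∂P =
      w.sum fun I c => c * (∫ ω, (timeAugment (X ω : BVPath n)).signature I.1 ∂P) I.2 := by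
  simp only [pairing, Finsupp.sum]
  rw [integral_finsetSum _ fun I _ => ((integrable_signature hK hX I.1).eval I.2).const_mul _]
  refine Finset.sum_congr rfl fun I _ => ?_
  rw [integral_const_mul, integral_signature_apply hK hX]

theorem integrable_comp_augmentOn (f : (timeAugment '' K) →ᵇ ℝ) (hX : Measurable X) :
    Integrable (fun ω => f (augmentOn K (X ω))) P :=
  Integrable.of_bound (f.continuous.measurable.comp
    ((continuous_augmentOn K).measurable.comp hX)).aestronglyMeasurable ‖f‖
    (Eventually.of_forall fun _ => f.norm_coe_le_norm _)

theorem abs_integral_sub_integral_pairing_le (hK : IsCompact K) (hX : Measurable X)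
    (f : (timeAugment '' K) →ᵇ ℝ) {w : (Σ m : ℕ, (Fin m → Fin (n + 1))) →₀ ℝ} {ε : ℝ}
    (hw : ∀ x : timeAugment '' K, |f x - pairing w x| < ε) :
    |(∫ ω, f (augmentOn K (X ω)) ∂P) - ∫ ω, pairing w (timeAugment (X ω : BVPath n)) ∂P| ≤ ε := by
  have hp : Integrable (fun ω => pairing w (timeAugment (X ω : BVPath n))) P :=
    integrable_comp_of_continuous hK ((continuous_pairing w).comp continuous_timeAugment) hX
  rw [← integral_sub (integrable_comp_augmentOn f hX) hp]
  refine (norm_integral_le_of_norm_le_const (μ := P) (C := ε)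
    (f := fun ω => f (augmentOn K (X ω)) - pairing w (timeAugment (X ω : BVPath n)))
    (Eventually.of_forall fun ω => (hw (augmentOn K (X ω))).le)).trans_eq ?_
  simp

end Expectation

/-- The expected signature determines the law of a random time-augmented path. -/
theorem map_augmentOn_eq_of_expected_signature_eq {K : Set (BVPath n)} (hK : IsCompact K)
    {Ω : Type*} [MeasurableSpace Ω] {P : Measure Ω} [IsProbabilityMeasure P] {X : Ω → K}
    {Ω' : Type*} [MeasurableSpace Ω'] {P' : Measure Ω'} [IsProbabilityMeasure P'] {X' : Ω' → K}
    (hX : Measurable X) (hX' : Measurable X')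
    (h : ∀ m : ℕ, ∫ ω, (timeAugment (X ω : BVPath n)).signature m ∂P =
      ∫ ω, (timeAugment (X' ω : BVPath n)).signature m ∂P') :
    P.map (fun ω => augmentOn K (X ω)) = P'.map (fun ω => augmentOn K (X' ω)) := by
  have hm := (continuous_augmentOn K).measurable.comp hX
  have hm' := (continuous_augmentOn K).measurable.comp hX'
  have := Measure.isProbabilityMeasure_map (μ := P) hm.aemeasurable
  have := Measure.isProbabilityMeasure_map (μ := P') hm'.aemeasurable
  refine ext_of_forall_integral_eq_of_IsFiniteMeasure
    (μ := P.map (augmentOn K ∘ X)) (ν := P'.map (augmentOn K ∘ X')) fun f => ?_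
  rw [integral_map hm.aemeasurable f.continuous.measurable.aestronglyMeasurable,
    integral_map hm'.aemeasurable f.continuous.measurable.aestronglyMeasurable]
  -- One functional approximates `f` within `ε / 2` under both laws, and its two expectations
  -- coincide.
  refine eq_of_forall_dist_le fun ε hε => ?_
  obtain ⟨w, hw⟩ := exists_pairing_near hK f (half_pos hε)
  have h1 := abs_integral_sub_integral_pairing_le (P := P) hK hX f hw
  have h2 := abs_integral_sub_integral_pairing_le (P := P') hK hX' f hw
  rw [integral_pairing hK hX] at h1
  rw [integral_pairing hK hX'] at h2
  simp_rw [h] at h1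
  rw [Real.dist_eq]
  simp only [Function.comp_apply]
  rw [abs_le] at h1 h2 ⊢
  constructor <;> linarith [h1.1, h1.2, h2.1, h2.2]

/-- Weak convergence of random time-augmented paths is convergence of the expected signatures. -/
theorem tendsto_integral_iff_tendsto_expected_signature {K : Set (BVPath n)} (hK : IsCompact K)
    {Ω : Type*} [MeasurableSpace Ω] {P : Measure Ω} [IsProbabilityMeasure P] {X : Ω → K}
    {Ω' : ℕ → Type*} [∀ k, MeasurableSpace (Ω' k)] {P' : ∀ k, Measure (Ω' k)}
    [∀ k, IsProbabilityMeasure (P' k)] {X' : ∀ k, Ω' k → K} (hX : Measurable X)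
    (hX' : ∀ k, Measurable (X' k)) :
    (∀ f : (timeAugment '' K) →ᵇ ℝ,
      Tendsto (fun k => ∫ ω, f (augmentOn K (X' k ω)) ∂(P' k)) atTop
        (𝓝 (∫ ω, f (augmentOn K (X ω)) ∂P))) ↔
    ∀ m : ℕ,
      Tendsto (fun k => ∫ ω, (timeAugment (X' k ω : BVPath n)).signature m ∂(P' k)) atTop
        (𝓝 (∫ ω, (timeAugment (X ω : BVPath n)).signature m ∂P)) := by
  constructor
  · intro h m
    refine tendsto_pi_nhds.2 fun I => ?_
    have : CompactSpace (timeAugment '' K) :=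
      isCompact_iff_compactSpace.1 (hK.image continuous_timeAugment)
    -- By compactness each signature coordinate is itself an admissible bounded test function.
    have := h (BoundedContinuousFunction.mkOfCompact
      ⟨fun z : timeAugment '' K => (z : BVPath (n + 1)).signature m I,
        (continuous_signature m I).comp continuous_subtype_val⟩)
    simp_rw [integral_signature_apply hK hX, fun k => integral_signature_apply hK (hX' k)
      (P := P' k) m I]
    exact this
  · intro h f
    rw [Metric.tendsto_nhds]
    intro ε hε
    -- One third for each replacement of `f` by the functional (under `P' k` uniformly in `k`, and
    -- under `P`), one for the convergence of its expectations.
    obtain ⟨w, hw⟩ := exists_pairing_near hK f (by positivity : 0 < ε / 3)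
    have hlim : Tendsto (fun k => ∫ ω, pairing w (timeAugment (X' k ω : BVPath n)) ∂(P' k)) atTop
        (𝓝 (∫ ω, pairing w (timeAugment (X ω : BVPath n)) ∂P)) := by
      simp_rw [integral_pairing hK hX, fun k => integral_pairing hK (hX' k) (P := P' k) w]
      exact tendsto_finsetSum _ fun I _ => (tendsto_pi_nhds.1 (h I.1) I.2).const_mul _
    filter_upwards [Metric.tendsto_nhds.1 hlim (ε / 3) (by positivity)] with k hk
    have h1 := abs_integral_sub_integral_pairing_le (P := P) hK hX f hw
    have h2 := abs_integral_sub_integral_pairing_le (P := P' k) hK (hX' k) f hw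
    rw [Real.dist_eq] at hk ⊢
    rw [abs_le] at h1 h2
    rw [abs_lt] at hk ⊢
    constructor <;> linarith [h1.1, h1.2, h2.1, h2.2, hk.1, hk.2]

end BVPath

/-! ### The main theorem -/

theorem mainTheorem2 (d : ℕ) (K : Set (BVPath d)) (hK : IsCompact K) :
    -- uniform density of the linear functionals of the signature
    (∀ f : (BVPath.timeAugment '' K) →ᵇ ℝ, ∀ ε : ℝ, 0 < ε →
      ∃ w : (Σ m : ℕ, (Fin m → Fin (d + 1))) →₀ ℝ,
        (⨆ x : K, ‖f (BVPath.augmentOn K x) -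
          BVPath.pairing w (BVPath.timeAugment (x : BVPath d))‖ₑ) < ENNReal.ofReal ε) ∧
    -- the expected signature of a `K`-valued random variable exists
    (∀ (Ω : Type*) [MeasurableSpace Ω] (P : Measure Ω) [IsProbabilityMeasure P] (X : Ω → K),
      Measurable X → ∀ m : ℕ,
        Integrable (fun ω => (BVPath.timeAugment (X ω : BVPath d)).signature m) P) ∧
    -- the expected signature determines the law
    (∀ (Ω : Type*) [MeasurableSpace Ω] (P : Measure Ω) [IsProbabilityMeasure P] (X : Ω → K)
      (Ω' : Type*) [MeasurableSpace Ω'] (P' : Measure Ω') [IsProbabilityMeasure P'] (X' : Ω' → K),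
      Measurable X → Measurable X' →
      (∀ m : ℕ, ∫ ω, (BVPath.timeAugment (X ω : BVPath d)).signature m ∂P =
        ∫ ω, (BVPath.timeAugment (X' ω : BVPath d)).signature m ∂P') →
      P.map (fun ω => BVPath.augmentOn K (X ω)) =
        P'.map (fun ω => BVPath.augmentOn K (X' ω))) ∧
    -- weak convergence is convergence of the expected signature in every degree
    (∀ (Ω : Type*) [MeasurableSpace Ω] (P : Measure Ω) [IsProbabilityMeasure P] (X : Ω → K)
      (Ω' : ℕ → Type*) [∀ k, MeasurableSpace (Ω' k)] (P' : ∀ k, Measure (Ω' k))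
      [∀ k, IsProbabilityMeasure (P' k)] (X' : ∀ k, Ω' k → K),
      Measurable X → (∀ k, Measurable (X' k)) →
      ((∀ f : (BVPath.timeAugment '' K) →ᵇ ℝ,
          Tendsto (fun k => ∫ ω, f (BVPath.augmentOn K (X' k ω)) ∂(P' k)) atTop
            (𝓝 (∫ ω, f (BVPath.augmentOn K (X ω)) ∂P))) ↔
        ∀ m : ℕ,
          Tendsto (fun k => ∫ ω, (BVPath.timeAugment (X' k ω : BVPath d)).signature m ∂(P' k)) atTop
            (𝓝 (∫ ω, (BVPath.timeAugment (X ω : BVPath d)).signature m ∂P)))) := by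
  refine ⟨fun f ε hε => ?_, fun Ω _ P _ X hX m => BVPath.integrable_signature hK hX m,
    fun Ω _ P _ X Ω' _ P' _ X' hX hX' h =>
      BVPath.map_augmentOn_eq_of_expected_signature_eq hK hX hX' h,
    fun Ω _ P _ X Ω' _ P' _ X' hX hX' =>
      BVPath.tendsto_integral_iff_tendsto_expected_signature hK hX hX'⟩
  -- A strict pointwise bound only gives `≤` for the supremum; halving `ε` restores strictness.
  obtain ⟨w, hw⟩ := BVPath.exists_pairing_near hK f (half_pos hε)
  refine ⟨w, (iSup_le fun x => ?_).trans_lt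
    ((ENNReal.ofReal_lt_ofReal_iff hε).2 (half_lt_self hε))⟩
  rw [Real.enorm_eq_ofReal_abs]
  exact ENNReal.ofReal_le_ofReal (hw (BVPath.augmentOn K x)).le
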